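/- **Setting.** Let $(\Omega,P)$ be a probability space (the solution space; a uniformly sampled solution is a sample from $P$) and let $c:\Omega\to\mathbb R$ be the (measurable) cost function. Write $X_c=c$ for the cost as a random variable and $F_{X_c}(x)=P(c\le x)$ for its cumulative distribution function. For a measurable $q:\Omega\to\mathbb R$, an integer $r\ge 1$ and angles $\beta_1,\dots,\beta_r,\gamma_1,\dots,\gamma_r\in\mathbb R$, the Grover-based QAOA of depth $r$ produces the state $$|\psi^{(r)}\rangle = U_M(\beta_r)U_P(\gamma_r)\cdots U_M(\beta_1)U_P(\gamma_1)|s\rangle\in L^2(\Omega,P;\mathbb C),$$ where $|s\rangle$ is the constant function $1$ (the uniform superposition), $U_M(\beta)=e^{i\beta H_M}$ with the Grover mixer $H_M=|s\rangle\langle s|$, and $U_P(\gamma)=e^{i\gamma H_Q}$ with $H_Q$ the multiplication by $q$, so that $U_P(\gamma)$ is multiplication by $e^{i\gamma q}$. Its expectation value is $E_r=\int_\Omega c\,|\psi^{(r)}|^2\,dP$. **Statement.** Assume that $X_c$ has finite mean and is a continuous random variable with probability density function $f_{X_c}$, that its support has a minimum $R^{min}_{X_c}$, and that $f_{X_c}(R^{min}_{X_c})=a$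 with $0<a<\infty$, where the value of the density at the minimum is the right derivative of $F_{X_c}$ at that point (as it is whenever $f_{X_c}$ is right-continuous there). Then for every Grover-based QAOA $E_r$ is well defined (the integral converges absolutely), and $$F_{X_c}(E_r)=\Omega\!\left(\frac1{r^2}\right),$$ uniformly in $q$ and in the angles: there is a constant $C>0$, which may depend on $(\Omega,P,c)$ but not on $r$, $q$ or the angles, such that $F_{X_c}(E_r)\ge C/r^2$ for all $r\ge 1$, all $q$ and all $\beta_1,\dots,\beta_r,\gamma_1,\dots,\gamma_r$. Thus the Grover mixer gives at most a quadratic speed-up over brute force. -/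

import Mathlib

open MeasureTheory

namespace GroverQAOA

noncomputable section

/-! The solution space is a probability space `(Ω, P)`: "sampling a solution uniformly" means
sampling from `P`. The Hilbert space of the algorithm is `L²(Ω, P; ℂ)`, and a state `ψ` yields a
solution in `A` with probability `∫_A |ψ|² dP`. For a finite set of `M` solutions with the uniform
measure this is the usual space spanned by the basis states `|k⟩`, an amplitude `a k` being
represented by `ψ k = √M * a k`. A general `P` is what a continuous cost distribution needs. -/

variable {Ω : Type*} [MeasurableSpace Ω]

/-- The uniform superposition `|s⟩`: the constant function `1`. -/
def uniformState (P : Measure Ω) [IsProbabilityMeasure P] : Lp ℂ 2 P :=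
  Lp.const 2 P (1 : ℂ)

/-- The Grover mixer Hamiltonian `H_M = |s⟩⟨s|`. -/
def mixerHamiltonian (P : Measure Ω) [IsProbabilityMeasure P] : Lp ℂ 2 P →L[ℂ] Lp ℂ 2 P :=
  InnerProductSpace.rankOne ℂ (uniformState P) (uniformState P)

/-- The mixing operator `U_M(β) = exp (i β H_M)`. -/
def mixer (P : Measure Ω) [IsProbabilityMeasure P] (β : ℝ) : Lp ℂ 2 P →L[ℂ] Lp ℂ 2 P :=
  NormedSpace.exp ((Complex.I * (β : ℂ)) • mixerHamiltonian P)

/-- The phases `e^{i γ q(ω)}` are measurable and bounded. -/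
theorem memLp_phase (P : Measure Ω) [IsProbabilityMeasure P] {q : Ω → ℝ} (hq : Measurable q)
    (γ : ℝ) : MemLp (fun ω => Complex.exp (Complex.I * (γ : ℂ) * (q ω : ℂ))) ⊤ P := by
  refine memLp_top_of_bound (by fun_prop) 1 (Filter.Eventually.of_forall fun ω => ?_)
  have h : Complex.I * (γ : ℂ) * (q ω : ℂ) = ((γ * q ω : ℝ) : ℂ) * Complex.I := by
    push_cast
    ring
  rw [h, Complex.norm_exp_ofReal_mul_I]

/-- Multiplication by the phase keeps a state square integrable. -/
theorem memLp_phase_mul (P : Measure Ω) [IsProbabilityMeasure P] {q : Ω → ℝ} (hq : Measurable q)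
    (γ : ℝ) (ψ : Lp ℂ 2 P) :
    MemLp (fun ω => Complex.exp (Complex.I * (γ : ℂ) * (q ω : ℂ)) * ψ ω) 2 P :=
  (Lp.memLp ψ).mul (memLp_phase P hq γ)

/-- The phase separation operator `U_P(γ) = exp (i γ H_Q)`, where `H_Q` is diagonal with value
`q ω` at the solution `ω`; that is, multiplication by `e^{i γ q(ω)}`. -/
def phaseSeparator (P : Measure Ω) [IsProbabilityMeasure P] {q : Ω → ℝ} (hq : Measurable q)
    (γ : ℝ) (ψ : Lp ℂ 2 P) : Lp ℂ 2 P :=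
  (memLp_phase_mul P hq γ ψ).toLp _

/-- The state `U_M(β_r) U_P(γ_r) ⋯ U_M(β_1) U_P(γ_1) |s⟩` after `r` rounds. -/
def state (P : Measure Ω) [IsProbabilityMeasure P] {q : Ω → ℝ} (hq : Measurable q) :
    (r : ℕ) → (β γ : Fin r → ℝ) → Lp ℂ 2 P
  | 0, _, _ => uniformState P
  | r + 1, β, γ =>
      mixer P (β (Fin.last r)) (phaseSeparator P hq (γ (Fin.last r))
        (state P hq r (fun j => β j.castSucc) (fun j => γ j.castSucc)))

/-- The expectation value `⟨ψ|H_C|ψ⟩` of the Hamiltonian that is diagonal with value `c ω` at the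
solution `ω`. -/
def expectation (P : Measure Ω) (c : Ω → ℝ) (ψ : Lp ℂ 2 P) : ℝ :=
  ∫ ω, c ω * ‖ψ ω‖ ^ 2 ∂P

end

end GroverQAOA

/-!
The reason for the bound is that one round of the algorithm can only add a constant to the
amplitudes. The mixer is `1 + (e^{iβ} - 1) |s⟩⟨s|`, because `|s⟩⟨s|` is idempotent
(`IsIdempotentElem.exp_smul`). It therefore adds to a unit vector `φ` the constant function
`(e^{iβ} - 1) ⟨s|φ⟩`, of modulus at most `2`, while the phase separator leaves all moduli
unchanged. Hence `|ψ| ≤ 2 r + 1 ≤ 3 r` almost everywhere after `r` rounds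
(`norm_state_le`), and `|ψ|²` is a probability density with respect to `P` that is bounded by
`9 r²` (`integral_norm_state_sq`).

Such a density gives the event `c ≤ m + δ` mass at most `9 r² F(m + δ)`, where `F` is the cumulative
distribution function of the cost and `m` the minimum of its support. Since `F` has right derivative
`a` at `m`, this is at most `1 / 2` for `δ` a suitable constant multiple of `1 / r²`. At least half
of the mass then has cost above `m + δ`, and none has cost below `m`, so that the expectation is at
least `m + δ / 2` (`add_half_le_integral_mul`). Finally `F (m + δ / 2)` is at least
`(a / 2) (δ / 2)`, which is a constant multiple of `1 / r²`.
-/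

open scoped Nat in
/-- The exponential of a multiple of an idempotent: `p ^ n = p` for `n ≥ 1` in the power series. -/
theorem IsIdempotentElem.exp_smul {A : Type*} [NormedRing A] [NormedAlgebra ℂ A] [CompleteSpace A]
    {p : A} (hp : IsIdempotentElem p) (z : ℂ) :
    NormedSpace.exp (z • p) = 1 + (Complex.exp z - 1) • p := by
  have h1 := NormedSpace.exp_series_hasSum_exp' (𝕂 := ℂ) (z • p)
  have h2 := NormedSpace.exp_series_hasSum_exp' (𝕂 := ℂ) z
  rw [← Complex.exp_eq_exp_ℂ] at h2
  have h3 := (h2.smul_const p).add (hasSum_single (f := fun n : ℕ => if n = 0 then 1 - p else 0) 0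
    (fun n hn => if_neg hn))
  have h4 : (fun n : ℕ => ((n ! : ℂ)⁻¹ • z ^ n) • p + if n = 0 then 1 - p else 0)
      = fun n : ℕ => (n ! : ℂ)⁻¹ • (z • p) ^ n := by
    funext n
    rcases n with _ | n
    · simp
    · simp [smul_pow, hp.pow_succ_eq, smul_smul]
  rw [h4] at h3
  rw [h1.unique h3, if_pos rfl, sub_smul, one_smul]
  abel

namespace GroverQAOA

variable {Ω : Type*} [MeasurableSpace Ω]

theorem norm_uniformState (P : Measure Ω) [IsProbabilityMeasure P] : ‖uniformState P‖ = 1 := by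
  simp [uniformState, Lp.norm_const]

theorem mixer_apply (P : Measure Ω) [IsProbabilityMeasure P] (β : ℝ) (ψ : Lp ℂ 2 P) :
    mixer P β ψ = ψ + Lp.const 2 P
      ((Complex.exp (Complex.I * β) - 1) * inner ℂ (uniformState P) ψ) := by
  have h := (InnerProductSpace.isIdempotentElem_rankOne_self (𝕜 := ℂ)
    (norm_uniformState P)).exp_smul (Complex.I * β)
  have hs (z : ℂ) : z • uniformState P = Lp.const 2 P z := by
    simpa [uniformState] using! ((Lp.constₗ 2 P ℂ).map_smul z (1 : ℂ)).symm
  rw [mixer, mixerHamiltonian, h]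
  rw [← hs]
  simp [smul_smul]

theorem norm_mixer_apply (P : Measure Ω) [IsProbabilityMeasure P] (β : ℝ) (ψ : Lp ℂ 2 P) :
    ‖mixer P β ψ‖ = ‖ψ‖ := by
  have hsa : IsSelfAdjoint ((β : ℂ) • mixerHamiltonian P) :=
    IsSelfAdjoint.smul (by simp [IsSelfAdjoint])
      (InnerProductSpace.isStarProjection_rankOne_self (norm_uniformState P)).isSelfAdjoint
  have hu := (selfAdjoint.expUnitary (A := Lp ℂ 2 P →L[ℂ] Lp ℂ 2 P) ⟨_, hsa⟩).2
  rw [selfAdjoint.expUnitary_coe, smul_smul] at hu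
  exact ContinuousLinearMap.norm_map_of_mem_unitary hu ψ

theorem norm_phaseSeparator_coe (P : Measure Ω) [IsProbabilityMeasure P] {q : Ω → ℝ}
    (hq : Measurable q) (γ : ℝ) (ψ : Lp ℂ 2 P) :
    ∀ᵐ ω ∂P, ‖phaseSeparator P hq γ ψ ω‖ = ‖ψ ω‖ := by
  filter_upwards [(memLp_phase_mul P hq γ ψ).coeFn_toLp] with ω hω
  have h : Complex.I * (γ : ℂ) * (q ω : ℂ) = Complex.I * ((γ * q ω : ℝ) : ℂ) := by
    push_cast
    ring
  rw [phaseSeparator, hω, norm_mul, h, Complex.norm_exp_I_mul_ofReal, one_mul]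

theorem norm_phaseSeparator (P : Measure Ω) [IsProbabilityMeasure P] {q : Ω → ℝ}
    (hq : Measurable q) (γ : ℝ) (ψ : Lp ℂ 2 P) : ‖phaseSeparator P hq γ ψ‖ = ‖ψ‖ := by
  rw [Lp.norm_def, Lp.norm_def, eLpNorm_congr_norm_ae (norm_phaseSeparator_coe P hq γ ψ)]

theorem norm_state (P : Measure Ω) [IsProbabilityMeasure P] {q : Ω → ℝ} (hq : Measurable q) :
    ∀ (r : ℕ) (β γ : Fin r → ℝ), ‖state P hq r β γ‖ = 1
  | 0, _, _ => norm_uniformState P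
  | r + 1, β, γ => by
    rw [state, norm_mixer_apply, norm_phaseSeparator, norm_state P hq r]

/-- Each round adds at most `2` to the modulus of an amplitude. -/
theorem norm_state_le (P : Measure Ω) [IsProbabilityMeasure P] {q : Ω → ℝ} (hq : Measurable q) :
    ∀ (r : ℕ) (β γ : Fin r → ℝ), ∀ᵐ ω ∂P, ‖state P hq r β γ ω‖ ≤ 2 * r + 1
  | 0, _, _ => by
    refine Filter.Eventually.of_forall fun ω => ?_
    simp [state, uniformState]
  | r + 1, β, γ => by
    rw [state, mixer_apply]
    set ψ := state P hq r (fun j => β j.castSucc) (fun j => γ j.castSucc) with hψ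
    set φ := phaseSeparator P hq (γ (Fin.last r)) ψ with hφ
    set z := (Complex.exp (Complex.I * (β (Fin.last r) : ℂ)) - 1) * inner ℂ (uniformState P) φ
      with hz
    have hφ1 : ‖φ‖ = 1 := by rw [hφ, norm_phaseSeparator, hψ, norm_state]
    have hinner : ‖inner ℂ (uniformState P) φ‖ ≤ 1 := by
      simpa [norm_uniformState, hφ1] using norm_inner_le_norm (𝕜 := ℂ) (uniformState P) φ
    have hexp : ‖Complex.exp (Complex.I * (β (Fin.last r) : ℂ)) - 1‖ ≤ 2 := by
      refine (norm_sub_le _ _).trans ?_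
      rw [Complex.norm_exp_I_mul_ofReal, norm_one]
      norm_num
    have hz2 : ‖z‖ ≤ 2 := by
      rw [hz, norm_mul]
      nlinarith [norm_nonneg (inner ℂ (uniformState P) φ)]
    filter_upwards [Lp.coeFn_add φ (Lp.const 2 P z), Lp.coeFn_const (p := 2) (μ := P) (c := z),
      norm_phaseSeparator_coe P hq (γ (Fin.last r)) ψ,
      norm_state_le P hq r (fun j => β j.castSucc) (fun j => γ j.castSucc)] with ω h1 h2 h3 h4
    rw [h1, Pi.add_apply, h2]
    refine (norm_add_le _ _).trans ?_
    rw [hφ, h3]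
    simp only [Function.const_apply]
    push_cast
    linarith

theorem integral_norm_state_sq (P : Measure Ω) [IsProbabilityMeasure P] {q : Ω → ℝ}
    (hq : Measurable q) (r : ℕ) (β γ : Fin r → ℝ) : ∫ ω, ‖state P hq r β γ ω‖ ^ 2 ∂P = 1 := by
  have h := L2.inner_def (𝕜 := ℂ) (state P hq r β γ) (state P hq r β γ)
  simp only [inner_self_eq_norm_sq_to_K, norm_state] at h
  have h2 := integral_ofReal (𝕜 := ℂ) (μ := P) (f := fun ω => ‖state P hq r β γ ω‖ ^ 2)
  push_cast at h2
  rw [h2] at h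
  rw [RCLike.ofReal_one, one_pow] at h
  exact RCLike.ofReal_injective (K := ℂ) (h.symm.trans RCLike.ofReal_one.symm)

/-- If the density `g` is at most `K` and `c ≤ m + δ` has probability at most `1 / (2 K)`, then `g`
puts at least half of its mass on `c > m + δ`. -/
theorem add_half_le_integral_mul {P : Measure Ω} [IsProbabilityMeasure P] {c g : Ω → ℝ}
    (hc : Measurable c) {m δ K : ℝ} (hδ : 0 ≤ δ)
    (hm : ∀ᵐ ω ∂P, m ≤ c ω) (hg : Integrable g P) (hcg : Integrable (fun ω => c ω * g ω) P)
    (hg0 : ∀ ω, 0 ≤ g ω) (hgK : ∀ᵐ ω ∂P, g ω ≤ K) (hg1 : ∫ ω, g ω ∂P = 1)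
    (hK : K * P.real {ω | c ω ≤ m + δ} ≤ 1 / 2) :
    m + δ / 2 ≤ ∫ ω, c ω * g ω ∂P := by
  set S := {ω | c ω ≤ m + δ} with hS
  have hSm : MeasurableSet S := measurableSet_le hc measurable_const
  have hind : Integrable (S.indicator fun _ => K) P := (integrable_const K).indicator hSm
  have hle : ∫ ω, ((m + δ) * g ω - δ * S.indicator (fun _ => K) ω) ∂P ≤ ∫ ω, c ω * g ω ∂P := by
    refine integral_mono_ae ((hg.const_mul _).sub (hind.const_mul _)) hcg ?_
    filter_upwards [hm, hgK] with ω h1 h2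
    by_cases hω : ω ∈ S
    · simp only [Set.indicator_of_mem hω]
      nlinarith [mul_nonneg (sub_nonneg.2 h1) (hg0 ω), mul_nonneg hδ (sub_nonneg.2 h2)]
    · simp only [Set.indicator_of_notMem hω]
      have : m + δ < c ω := not_le.1 hω
      nlinarith [mul_nonneg (sub_nonneg.2 this.le) (hg0 ω)]
  rw [integral_sub (hg.const_mul _) (hind.const_mul _), integral_const_mul, integral_const_mul,
    hg1, integral_indicator_const _ hSm, smul_eq_mul] at hle
  nlinarith

theorem ae_le_of_isLeast_support {μ : Measure ℝ} {m : ℝ} (hm : IsLeast μ.support m) :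
    ∀ᵐ x ∂μ, m ≤ x := by
  filter_upwards [Measure.support_mem_ae (μ := μ)] with x hx using hm.2 hx

theorem cdf_eq_zero_of_isLeast_support {μ : Measure ℝ} [IsProbabilityMeasure μ] [NullSingletonClass μ] {m : ℝ}
    (hm : IsLeast μ.support m) : ProbabilityTheory.cdf μ m = 0 := by
  rw [ProbabilityTheory.cdf_eq_real, measureReal_def, ← measure_congr Iio_ae_eq_Iic]
  have h : μ (Set.Iio m) = 0 := by
    simpa [ae_iff, Set.Iio] using ae_le_of_isLeast_support hm
  simp [h]

/-- A function that vanishes at `m` and has right derivative `a > 0` there lies between two linear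
functions on a right neighbourhood of `m`. -/
theorem exists_linear_bounds {F : ℝ → ℝ} {m a : ℝ} (ha : 0 < a) (hF : F m = 0)
    (h : HasDerivWithinAt F a (Set.Ici m) m) :
    ∃ δ : ℝ, 0 < δ ∧ ∀ t, 0 ≤ t → t ≤ δ → a / 2 * t ≤ F (m + t) ∧ F (m + t) ≤ 2 * a * t := by
  have h1 := (hasDerivWithinAt_iff_isLittleO.1 h).def (half_pos ha)
  obtain ⟨u, hu, hus⟩ := mem_nhdsGE_iff_exists_Icc_subset.1 h1
  refine ⟨u - m, sub_pos.2 hu, fun t ht0 ht => ?_⟩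
  have h2 := @hus (m + t) ⟨by linarith, by linarith⟩
  simp only [Set.mem_ofPred_eq, hF, sub_zero, add_sub_cancel_left, smul_eq_mul,
    Real.norm_eq_abs, abs_of_nonneg ht0] at h2
  have h3 := abs_le.1 h2
  have := mul_nonneg ha.le ht0
  constructor <;> linarith

end GroverQAOA

theorem corollary4 {Ω : Type*} [MeasurableSpace Ω] (P : Measure Ω) [IsProbabilityMeasure P]
    -- the cost function, with finite mean
    (c : Ω → ℝ) (hc : Measurable c) (hci : Integrable c P)
    -- its distribution is continuous, with probability density function `f`
    (f : ℝ → ℝ) (hf : Measurable f) (hf0 : ∀ x, 0 ≤ f x)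
    (hpdf : P.map c = volume.withDensity (fun x => ENNReal.ofReal (f x)))
    -- `m` is the minimum of the support of the distribution
    (m : ℝ) (hm : IsLeast (P.map c).support m)
    -- the density at the minimum, meaning the right derivative of the cdf there, is `a`
    (a : ℝ) (ha : 0 < a) (hfm : f m = a)
    (hderiv : HasDerivWithinAt (ProbabilityTheory.cdf (P.map c)) (f m) (Set.Ici m) m) :
    ∃ C : ℝ, 0 < C ∧ ∀ r : ℕ, 1 ≤ r →
      ∀ (q : Ω → ℝ) (hq : Measurable q) (β γ : Fin r → ℝ),
        Integrable (fun ω => c ω * ‖GroverQAOA.state P hq r β γ ω‖ ^ 2) P ∧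
        C / (r : ℝ) ^ 2 ≤ ProbabilityTheory.cdf (P.map c)
          (GroverQAOA.expectation P c (GroverQAOA.state P hq r β γ)) := by
  have hμ : IsProbabilityMeasure (P.map c) := Measure.isProbabilityMeasure_map hc.aemeasurable
  have hna : NullSingletonClass (P.map c) := hpdf ▸ inferInstance
  rw [hfm] at hderiv
  obtain ⟨δ₀, hδ₀, hF⟩ := GroverQAOA.exists_linear_bounds ha
    (GroverQAOA.cdf_eq_zero_of_isLeast_support hm) hderiv
  have hmc : ∀ᵐ ω ∂P, m ≤ c ω :=
    ae_of_ae_map hc.aemeasurable (GroverQAOA.ae_le_of_isLeast_support hm)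
  -- With `δ = ε / r²`, the factor `1 / (36 a)` makes `9 r² * (2 a δ) ≤ 1 / 2`.
  set ε := min δ₀ (1 / (36 * a)) with hε
  have hε0 : 0 < ε := lt_min hδ₀ (by positivity)
  refine ⟨a * ε / 4, by positivity, fun r hr q hq β γ => ?_⟩
  set ψ := GroverQAOA.state P hq r β γ with hψ
  have hr1 : (1 : ℝ) ≤ r := by exact_mod_cast hr
  have hbound : ∀ᵐ ω ∂P, ‖ψ ω‖ ^ 2 ≤ 9 * (r : ℝ) ^ 2 := by
    filter_upwards [GroverQAOA.norm_state_le P hq r β γ] with ω hω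
    calc ‖ψ ω‖ ^ 2 ≤ (3 * (r : ℝ)) ^ 2 := by gcongr; linarith
      _ = 9 * (r : ℝ) ^ 2 := by ring
  have hmeas : AEStronglyMeasurable (fun ω => ‖ψ ω‖ ^ 2) P :=
    (Lp.aestronglyMeasurable ψ).norm.pow 2
  have hnorm : ∀ᵐ ω ∂P, ‖‖ψ ω‖ ^ 2‖ ≤ 9 * (r : ℝ) ^ 2 := by
    filter_upwards [hbound] with ω hω
    rwa [Real.norm_of_nonneg (by positivity)]
  have hint : Integrable (fun ω => c ω * ‖ψ ω‖ ^ 2) P := hci.mul_bdd hmeas hnorm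
  refine ⟨hint, ?_⟩
  set δ := ε / (r : ℝ) ^ 2 with hδ
  have hδ0 : 0 < δ := by positivity
  have hδε : δ ≤ ε := div_le_self hε0.le (one_le_pow₀ hr1)
  have hδδ₀ : δ ≤ δ₀ := hδε.trans (min_le_left _ _)
  have hδr : (r : ℝ) ^ 2 * δ = ε := by rw [hδ]; field_simp
  have hεa : a * ε ≤ 1 / 36 := by
    calc a * ε ≤ a * (1 / (36 * a)) := by gcongr; exact min_le_right _ _
      _ = 1 / 36 := by field_simp
  have hprob : P.real {ω | c ω ≤ m + δ} = ProbabilityTheory.cdf (P.map c) (m + δ) := by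
    rw [ProbabilityTheory.cdf_eq_real, map_measureReal_apply hc measurableSet_Iic]
    rfl
  have hmass : 9 * (r : ℝ) ^ 2 * P.real {ω | c ω ≤ m + δ} ≤ 1 / 2 := by
    rw [hprob]
    calc 9 * (r : ℝ) ^ 2 * ProbabilityTheory.cdf (P.map c) (m + δ)
        ≤ 9 * (r : ℝ) ^ 2 * (2 * a * δ) := by gcongr; exact (hF δ hδ0.le hδδ₀).2
      _ = 18 * a * ((r : ℝ) ^ 2 * δ) := by ring
      _ ≤ 1 / 2 := by rw [hδr]; linarith
  have hE : m + δ / 2 ≤ GroverQAOA.expectation P c ψ :=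
    GroverQAOA.add_half_le_integral_mul hc hδ0.le hmc
      (Integrable.of_bound hmeas _ hnorm) hint (fun ω => by positivity) hbound
      (GroverQAOA.integral_norm_state_sq P hq r β γ) hmass
  calc a * ε / 4 / (r : ℝ) ^ 2 = a / 2 * (δ / 2) := by rw [hδ]; ring
    _ ≤ ProbabilityTheory.cdf (P.map c) (m + δ / 2) := (hF _ (by linarith) (by linarith)).1
    _ ≤ _ := ProbabilityTheory.monotone_cdf _ hE
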